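/- Let $r,m\ge 1$ be integers. Let $\zeta_r$ denote the multiple zeta function of order $r$, $$\zeta_r(s)=\sum_{n_1,\dots,n_r=0}^{\infty}\frac{1}{(n_1+\cdots+n_r+r)^{s}}\qquad(\operatorname{Re} s>r),$$ continued analytically to $\mathbb C\setminus\{1,\dots,r\}$. For $\lambda\in\mathbb C\setminus(-\infty,0]$, with $\log$ the principal logarithm, let the $\lambda$-Bernoulli polynomials of order $r$ be defined by $$\left(\frac{\log\lambda+t}{\lambda e^{t}-1}\right)^{r}e^{xt}=\sum_{n=0}^{\infty}B^{(r)}_{n}(\lambda;x)\frac{t^{n}}{n!}\qquad(|t|\text{ small}),$$ where the removable singularity of $\frac{\log\lambda+t}{\lambda e^t-1}$ at $t=-\log\lambda$ is filled in by the value $1$. Then the continuation $\zeta_r$ exists, and for every $\lambda\in\mathbb C\setminus(-\infty,0]$ the following series converges absolutely and $$\zeta_r(-m)=(-\lambda)^{r}\,m!\sum_{j=0}^{\infty}\binom{-m-r-1}{j}(\log\lambda)^{j}\,\frac{B^{(r)}_{m+r+j}(\lambda;r)}{(m+r+j)!}.$$ -/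

import Mathlib

/-- The function `t ↦ (log lam + t) / (lam * exp t - 1)` of a complex variable (principal branch of
the logarithm), with its removable singularity at `t = -log lam` filled in by its limit `1`. For
`lam = 1` this is `t / (exp t - 1)`, with value `1` at `t = 0`. -/
noncomputable def lambdaBernoulliGen (lam t : ℂ) : ℂ :=
  if Complex.log lam + t = 0 then 1
  else (Complex.log lam + t) / (lam * Complex.exp t - 1)

/-- The value at `x` of the `n`-th lambda-Bernoulli polynomial of order `r`: the coefficient of
`t ^ n / n!` in the Taylor expansion at `t = 0` of
`((log lam + t) / (lam * exp t - 1)) ^ r * exp (x * t)`. -/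
noncomputable def lambdaBernoulli (r n : ℕ) (lam x : ℂ) : ℂ :=
  iteratedDeriv n (fun t : ℂ => lambdaBernoulliGen lam t ^ r * Complex.exp (x * t)) 0

/-- `Z` is the multiple zeta function of order `r`: it is the sum of the series
`∑ 1 / (n₁ + ⋯ + n_r + r) ^ s` over all `n₁, …, n_r ≥ 0` in the half-plane `Re s > r` in which the
series converges, and it is holomorphic on the complex plane without the points `1, …, r`
(values at these points are arbitrary). -/
structure IsMultipleZeta (r : ℕ) (Z : ℂ → ℂ) : Prop where
  hasSum : ∀ s : ℂ, (r : ℝ) < s.re →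
    HasSum (fun n : Fin r → ℕ => 1 / (((∑ i, n i) + r : ℕ) : ℂ) ^ s) (Z s)
  differentiableOn :
    DifferentiableOn ℂ Z {s : ℂ | ∀ k : ℕ, 1 ≤ k → k ≤ r → s ≠ (k : ℂ)}

/-!
Grouping the terms of the series for `ζ_r` by the value `N` of `n₁ + ⋯ + n_r` shows that
`ζ_{k+1}(s) = ∑ N, (N + k).choose k / (N + k + 1) ^ s`, hence
`ζ_{k+2}(s) = ζ_{k+1}(s - 1) / (k + 1) - ζ_{k+1}(s)`. This continues `ζ_r`, starting from the
Riemann zeta function. Nörlund's recurrence for the Bernoulli polynomials of higher order has the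
same shape at negative integers, so that `ζ_r(-m) = (-1) ^ r m! B_{m+r}^{(r)}(1; r) / (m + r)!`.

Since `λ exp t = exp (log λ + t)`, the generating function for `λ` is, up to the factor `λ ^ (-x)`,
the one for `λ = 1` translated by `log λ`. The series over `j` is therefore the Taylor expansion
about `log λ` of an iterated derivative of the generating function for `λ = 1`, evaluated at `0`.
It converges there because `|Im (log λ)| < π`, which makes `0` closer to `log λ` than any of the
singularities `2 * π * I * k`, `k ≠ 0`.
-/

section OrderRecursion

open Finset

theorem card_antidiagonalTuple_succ (k n : ℕ) :
    #(Finset.Nat.antidiagonalTuple (k + 1) n) = (n + k).choose k := by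
  classical
  have card_eq : #(piAntidiag (univ : Finset (Fin (k + 1))) n) =
      #((univ : Finset (Fin (k + 1))).finsuppAntidiag n) := by
    rw [finsuppAntidiag, card_map, card_attach]
  rw [← piAntidiag_univ_fin_eq_antidiagonalTuple, card_eq, card_finsuppAntidiag_nat_eq_choose,
    card_univ, Fintype.card_fin, show k + 1 + n - 1 = n + k by lia, Nat.choose_symm_add]

theorem hasSum_comp_sum_fin {E : Type*} [NormedAddCommGroup E] [CompleteSpace E] {k : ℕ}
    {g : ℕ → E} {a : E} (hg : Summable fun N => (N + k).choose k • ‖g N‖)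
    (ha : HasSum (fun N => (N + k).choose k • g N) a) :
    HasSum (fun n : Fin (k + 1) → ℕ => g (∑ i, n i)) a := by
  let e := Finset.Nat.sigmaAntidiagonalTupleEquivTuple (k + 1)
  have sum_e (p) : ∑ i, e p i = p.1 := Finset.Nat.mem_antidiagonalTuple.mp p.2.2
  have hasSum_fiber (N : ℕ) :
      HasSum (fun _ : Finset.Nat.antidiagonalTuple (k + 1) N => g N) ((N + k).choose k • g N) := by
    simpa [card_antidiagonalTuple_succ] using
      hasSum_fintype fun _ : Finset.Nat.antidiagonalTuple (k + 1) N => g N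
  have summable_fibers :
      Summable fun p : Σ N, Finset.Nat.antidiagonalTuple (k + 1) N => g p.1 := by
    refine .of_norm ((summable_sigma_of_nonneg fun _ => norm_nonneg _).2
      ⟨fun N => (hasSum_fintype _).summable, ?_⟩)
    simpa [card_antidiagonalTuple_succ] using hg
  rw [← e.hasSum_iff]
  simpa only [Function.comp_def, sum_e] using ha.sigma_of_hasSum hasSum_fiber summable_fibers

/-- The multiple zeta function of order `k + 1`. It is built from the Riemann zeta function by the
recursion `ζ_{k+2}(s) = ζ_{k+1}(s - 1) / (k + 1) - ζ_{k+1}(s)` on the order, which continues it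
analytically; the values at the poles `1, …, k + 1` are arbitrary. -/
noncomputable def multipleZetaSucc : ℕ → ℂ → ℂ
  | 0 => riemannZeta
  | k + 1 => fun s => multipleZetaSucc k (s - 1) / (k + 1) - multipleZetaSucc k s

theorem choose_div_cpow_sub_one_sub (M k : ℕ) (s : ℂ) :
    ((M + k).choose k : ℂ) / ((M + k + 1 : ℕ) : ℂ) ^ (s - 1) / (k + 1) -
        ((M + k).choose k : ℂ) / ((M + k + 1 : ℕ) : ℂ) ^ s =
      ((M + k).choose (k + 1) : ℂ) / ((M + k + 1 : ℕ) : ℂ) ^ s := by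
  have base_ne : ((M + k + 1 : ℕ) : ℂ) ≠ 0 := Nat.cast_ne_zero.mpr (M + k).succ_ne_zero
  have succ_ne : (k : ℂ) + 1 ≠ 0 := Nat.cast_add_one_ne_zero k
  have choose_succ : ((M + k).choose (k + 1) : ℂ) * (k + 1) = (M + k).choose k * M := by
    exact_mod_cast (by simpa using Nat.choose_succ_right_eq (M + k) k)
  rw [Complex.cpow_sub _ _ base_ne, Complex.cpow_one, eq_div_of_mul_eq succ_ne choose_succ]
  field_simp
  push_cast
  ring

theorem hasSum_multipleZetaSucc {k : ℕ} {s : ℂ} (hs : ((k + 1 : ℕ) : ℝ) < s.re) :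
    HasSum (fun M : ℕ => ((M + k).choose k : ℂ) / ((M + k + 1 : ℕ) : ℂ) ^ s)
      (multipleZetaSucc k s) := by
  induction k generalizing s with
  | zero =>
    replace hs : 1 < s.re := by simpa using hs
    have summable_shift := (summable_nat_add_iff 1).2 (Complex.summable_one_div_nat_cpow.2 hs)
    simpa [multipleZetaSucc, zeta_eq_tsum_one_div_nat_add_one_cpow hs] using summable_shift.hasSum
  | succ k ih =>
    push_cast at hs
    have hasSum_diff := ((ih (s := s - 1) (by simp; linarith)).div_const ((k : ℂ) + 1)).sub
      (ih (s := s) (by push_cast; linarith))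
    simp only [choose_div_cpow_sub_one_sub] at hasSum_diff
    rw [← hasSum_nat_add_iff' 1] at hasSum_diff
    simpa [add_assoc, add_comm 1, multipleZetaSucc] using hasSum_diff

theorem differentiableOn_multipleZetaSucc (k : ℕ) :
    DifferentiableOn ℂ (multipleZetaSucc k)
      {s : ℂ | ∀ j : ℕ, 1 ≤ j → j ≤ k + 1 → s ≠ (j : ℂ)} := by
  induction k with
  | zero =>
    exact fun s hs =>
      (differentiableAt_riemannZeta (by simpa using hs 1 le_rfl le_rfl)).differentiableWithinAt
  | succ k ih =>
    refine ((ih.comp (f := fun s => s - 1) (by fun_prop) fun s hs j _ hjk h => ?_).div_const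
      _).sub (ih.mono fun s hs j hj1 hjk => hs j hj1 (by lia))
    exact hs (j + 1) (by lia) (by lia) (by rw [Nat.cast_succ, ← h, sub_add_cancel])

theorem isMultipleZeta_multipleZetaSucc (k : ℕ) :
    IsMultipleZeta (k + 1) (multipleZetaSucc k) where
  hasSum s hs := by
    have hasSum_mult := hasSum_multipleZetaSucc hs
    refine hasSum_comp_sum_fin (g := fun N => 1 / ((N + (k + 1) : ℕ) : ℂ) ^ s) ?_ ?_
    · simpa [div_eq_mul_inv, add_assoc] using hasSum_mult.summable.norm
    · simpa [div_eq_mul_inv, add_assoc] using hasSum_mult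
  differentiableOn := differentiableOn_multipleZetaSucc k

end OrderRecursion

section Uniqueness

/-- The set `{1, …, r}` of poles of the multiple zeta function of order `r`. -/
def multipleZetaPoles (r : ℕ) : Set ℂ :=
  Nat.cast '' Set.Icc 1 r

theorem finite_multipleZetaPoles (r : ℕ) : (multipleZetaPoles r).Finite :=
  (Set.finite_Icc 1 r).image _

theorem compl_multipleZetaPoles (r : ℕ) :
    (multipleZetaPoles r)ᶜ = {s : ℂ | ∀ k : ℕ, 1 ≤ k → k ≤ r → s ≠ k} := by
  ext s
  simp [multipleZetaPoles, eq_comm]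

theorem neg_natCast_notMem_multipleZetaPoles (r m : ℕ) : -(m : ℂ) ∉ multipleZetaPoles r := by
  rintro ⟨j, hj, h⟩
  have : j + m = 0 := by exact_mod_cast eq_neg_iff_add_eq_zero.mp h
  have := hj.1
  lia

theorem IsMultipleZeta.analyticOnNhd {r : ℕ} {Z : ℂ → ℂ} (hZ : IsMultipleZeta r Z) :
    AnalyticOnNhd ℂ Z (multipleZetaPoles r)ᶜ :=
  (compl_multipleZetaPoles r ▸ hZ.differentiableOn).analyticOnNhd
    (finite_multipleZetaPoles r).isClosed.isOpen_compl

theorem IsMultipleZeta.eqOn {r : ℕ} {Z W : ℂ → ℂ} (hZ : IsMultipleZeta r Z)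
    (hW : IsMultipleZeta r W) : Set.EqOn Z W (multipleZetaPoles r)ᶜ := by
  have preconnected : IsPreconnected (multipleZetaPoles r)ᶜ :=
    ((finite_multipleZetaPoles r).countable.isConnected_compl_of_one_lt_rank
      (by simp)).isPreconnected
  have mem : ((r + 1 : ℕ) : ℂ) ∈ (multipleZetaPoles r)ᶜ := by
    rintro ⟨j, hj, h⟩
    have := hj.2
    have : j = r + 1 := Nat.cast_injective h
    lia
  have halfPlane_mem : {s : ℂ | (r : ℝ) < s.re} ∈ nhds ((r + 1 : ℕ) : ℂ) :=
    (isOpen_lt continuous_const Complex.continuous_re).mem_nhds (by simp)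
  exact hZ.analyticOnNhd.eqOn_of_preconnected_of_eventuallyEq hW.analyticOnNhd preconnected mem
    (Filter.mem_of_superset halfPlane_mem fun s hs => (hZ.hasSum s hs).unique (hW.hasSum s hs))

end Uniqueness

section TaylorCoefficients

open Finset

theorem iteratedDeriv_succ_id_mul_zero {𝕜 : Type*} [NontriviallyNormedField 𝕜] {f : 𝕜 → 𝕜} {n : ℕ}
    (hf : ContDiffAt 𝕜 (n + 1) f 0) :
    iteratedDeriv (n + 1) (fun u => u * f u) 0 = (n + 1) * iteratedDeriv n f 0 := by
  rw [iteratedDeriv_fun_mul contDiffAt_id (by exact_mod_cast hf),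
    sum_eq_single 1 (fun i _ hi => by simp [iteratedDeriv_fun_id_zero, hi]) (by simp)]
  simp

theorem iteratedDeriv_exp_sub_one_zero (n : ℕ) :
    iteratedDeriv n (fun u => Complex.exp u - 1) 0 = if n = 0 then 0 else 1 := by
  rw [iteratedDeriv_fun_sub (by fun_prop) (by fun_prop), iteratedDeriv_const]
  split_ifs with hn <;> simp [iteratedDeriv_eq_iterate, hn]

theorem hasSum_taylorSeries_iteratedDeriv_on_ball {E : Type*} [NormedAddCommGroup E]
    [NormedSpace ℂ E] [CompleteSpace E] {f : ℂ → E} {c z : ℂ} {R : ℝ}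
    (hf : DifferentiableOn ℂ f (Metric.ball c R)) (hz : z ∈ Metric.ball c R) (N : ℕ) :
    HasSum (fun j : ℕ => (j.factorial : ℂ)⁻¹ • (z - c) ^ j • iteratedDeriv (N + j) f c)
      (iteratedDeriv N f z) := by
  have differentiableOn_deriv :=
    ((hf.analyticOnNhd Metric.isOpen_ball).iterated_deriv N).differentiableOn
  simpa only [iteratedDeriv_eq_iterate, ← Function.iterate_add_apply, add_comm _ N] using
    Complex.hasSum_taylorSeries_on_ball differentiableOn_deriv hz

end TaylorCoefficients

section GeneratingFunction

open Complex Finset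

theorem re_eq_zero_of_exp_eq_one {u : ℂ} (h : exp u = 1) : u.re = 0 := by
  obtain ⟨n, rfl⟩ := exp_eq_one_iff.mp h
  simp

theorem two_pi_le_abs_im_of_exp_eq_one {u : ℂ} (h : exp u = 1) (hu : u ≠ 0) :
    2 * Real.pi ≤ |u.im| := by
  obtain ⟨n, rfl⟩ := exp_eq_one_iff.mp h
  have one_le_abs : (1 : ℝ) ≤ |(n : ℝ)| := by
    exact_mod_cast Int.one_le_abs (by rintro rfl; simp at hu)
  simpa [abs_mul, abs_of_pos Real.pi_pos] using
    le_mul_of_one_le_left Real.two_pi_pos.le one_le_abs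

-- The radius is the distance from `L` to the nearer of the two points `± 2 * π * I`.
theorem exists_ball_forall_exp_eq_one_imp {L : ℂ} (hL : |L.im| < Real.pi) :
    ∃ R : ℝ, ‖L‖ < R ∧ ∀ u ∈ Metric.ball L R, exp u = 1 → u = 0 := by
  refine ⟨√(L.re ^ 2 + (2 * Real.pi - |L.im|) ^ 2), ?_, fun u hu hexp => ?_⟩
  · rw [norm_eq_sqrt_sq_add_sq]
    refine Real.sqrt_lt_sqrt (by positivity) ?_
    nlinarith [sq_abs L.im, abs_nonneg L.im, Real.pi_pos]
  · contrapose! hu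
    have im_le : 2 * Real.pi - |L.im| ≤ |u.im - L.im| := by
      linarith [two_pi_le_abs_im_of_exp_eq_one hexp hu, abs_sub_abs_le_abs_sub u.im L.im]
    have im_sq_le : (2 * Real.pi - |L.im|) ^ 2 ≤ (u.im - L.im) ^ 2 :=
      sq_abs (u.im - L.im) ▸ pow_le_pow_left₀ (by linarith [Real.pi_pos]) im_le 2
    rw [Metric.mem_ball, not_lt, dist_eq_norm, norm_eq_sqrt_sq_add_sq, sub_re, sub_im,
      re_eq_zero_of_exp_eq_one hexp, zero_sub, neg_sq]
    gcongr

theorem eventually_nhds_zero_exp_eq_one_imp : ∀ᶠ u : ℂ in nhds 0, exp u = 1 → u = 0 := by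
  obtain ⟨R, hR, h⟩ := exists_ball_forall_exp_eq_one_imp (L := 0) (by simpa using Real.pi_pos)
  exact Filter.mem_of_superset (Metric.ball_mem_nhds 0 (by simpa using hR)) h

theorem lambdaBernoulliGen_one_mul_exp_sub_one {u : ℂ} (hu : exp u = 1 → u = 0) :
    lambdaBernoulliGen 1 u * (exp u - 1) = u := by
  rcases eq_or_ne u 0 with rfl | hu0
  · simp
  · have : exp u - 1 ≠ 0 := sub_ne_zero.mpr (mt hu hu0)
    simp [lambdaBernoulliGen, hu0, this]

theorem lambdaBernoulliGen_one_eq_inv_dslope_exp (u : ℂ) :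
    lambdaBernoulliGen 1 u = (dslope exp 0 u)⁻¹ := by
  rcases eq_or_ne u 0 with rfl | hu
  · simp [lambdaBernoulliGen]
  · simp [lambdaBernoulliGen, hu, dslope_of_ne _ hu, slope_def_field]

theorem differentiableAt_lambdaBernoulliGen_one {u : ℂ} (hu : exp u = 1 → u = 0) :
    DifferentiableAt ℂ (lambdaBernoulliGen 1) u := by
  have differentiable_dslope : Differentiable ℂ (dslope exp 0) := by
    rw [← differentiableOn_univ, differentiableOn_dslope Filter.univ_mem]
    exact differentiable_exp.differentiableOn
  have dslope_ne_zero : dslope exp 0 u ≠ 0 := by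
    rcases eq_or_ne u 0 with rfl | hu0
    · simp
    · simp [dslope_of_ne _ hu0, slope_def_field, hu0, sub_ne_zero, mt hu hu0]
  rw [funext lambdaBernoulliGen_one_eq_inv_dslope_exp]
  exact differentiable_dslope.differentiableAt.inv dslope_ne_zero

theorem mul_deriv_lambdaBernoulliGen_one :
    (fun u => u * deriv (lambdaBernoulliGen 1) u) =ᶠ[nhds 0]
      fun u => lambdaBernoulliGen 1 u - lambdaBernoulliGen 1 u ^ 2 * exp u := by
  filter_upwards [eventually_nhds_zero_exp_eq_one_imp.eventually_nhds] with u hu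
  have functional_eq := lambdaBernoulliGen_one_mul_exp_sub_one hu.self_of_nhds
  have deriv_eq : deriv (lambdaBernoulliGen 1) u * (exp u - 1) + lambdaBernoulliGen 1 u * exp u
      = 1 := by
    have hasDerivAt_prod := (differentiableAt_lambdaBernoulliGen_one
      hu.self_of_nhds).hasDerivAt.mul ((hasDerivAt_exp u).sub_const 1)
    exact hasDerivAt_prod.unique ((hasDerivAt_id u).congr_of_eventuallyEq
      (hu.mono fun _ => lambdaBernoulliGen_one_mul_exp_sub_one))
  linear_combination lambdaBernoulliGen 1 u * deriv_eq -
    deriv (lambdaBernoulliGen 1) u * functional_eq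

/-- The generating function `(u / (exp u - 1)) ^ r * exp (x * u)` of Nörlund's Bernoulli polynomials
of order `r`, that is, of the lambda-Bernoulli polynomials with `lam = 1`. -/
noncomputable def norlundGen (r : ℕ) (x u : ℂ) : ℂ :=
  lambdaBernoulliGen 1 u ^ r * exp (x * u)

theorem iteratedDeriv_norlundGen_zero (r n : ℕ) (x : ℂ) :
    iteratedDeriv n (norlundGen r x) 0 = lambdaBernoulli r n 1 x :=
  rfl

theorem differentiableAt_norlundGen (r : ℕ) (x : ℂ) {u : ℂ} (hu : exp u = 1 → u = 0) :
    DifferentiableAt ℂ (norlundGen r x) u := by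
  have := differentiableAt_lambdaBernoulliGen_one hu
  unfold norlundGen
  fun_prop

theorem analyticAt_norlundGen_zero (r : ℕ) (x : ℂ) : AnalyticAt ℂ (norlundGen r x) 0 :=
  analyticAt_iff_eventually_differentiableAt.mpr
    (eventually_nhds_zero_exp_eq_one_imp.mono fun _ => differentiableAt_norlundGen r x)

theorem mul_deriv_norlundGen (r : ℕ) (x : ℂ) :
    (fun u => u * deriv (norlundGen r x) u) =ᶠ[nhds 0] fun u =>
      r * norlundGen r x u - r * norlundGen (r + 1) (x + 1) u + x * (u * norlundGen r x u) := by
  filter_upwards [eventually_nhds_zero_exp_eq_one_imp, mul_deriv_lambdaBernoulliGen_one]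
    with u hu mul_deriv_gen
  have hasDerivAt_norlundGen := ((differentiableAt_lambdaBernoulliGen_one hu).hasDerivAt.pow r).mul
    ((hasDerivAt_id u).const_mul x).cexp
  rw [show deriv (norlundGen r x) u = _ from hasDerivAt_norlundGen.deriv]
  simp only [norlundGen, add_mul, one_mul, exp_add]
  rcases r with _ | r
  · simp only [Nat.cast_zero, zero_tsub, pow_zero, mul_one, zero_mul, id_eq, Pi.one_apply,
      one_mul, zero_add, pow_one, sub_self]
    ring
  · simp only [Nat.cast_add, Nat.cast_one, add_tsub_cancel_right, id_eq, Pi.pow_apply, mul_one]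
    linear_combination ((r + 1) * lambdaBernoulliGen 1 u ^ r * exp (x * u)) * mul_deriv_gen

end GeneratingFunction

section Norlund

open Complex Finset

theorem lambdaBernoulli_one_succ_order (r n : ℕ) (x : ℂ) :
    r * lambdaBernoulli (r + 1) (n + 1) 1 (x + 1) =
      (r - (n + 1)) * lambdaBernoulli r (n + 1) 1 x + (n + 1) * x * lambdaBernoulli r n 1 x := by
  have contDiffAt_gen (s : ℕ) (y : ℂ) (i : WithTop ℕ∞) : ContDiffAt ℂ i (norlundGen s y) 0 :=
    (analyticAt_norlundGen_zero s y).contDiffAt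
  have coeff_eq := (mul_deriv_norlundGen r x).iteratedDeriv_eq (n + 1)
  rw [iteratedDeriv_succ_id_mul_zero (analyticAt_norlundGen_zero r x).deriv.contDiffAt,
    ← iteratedDeriv_succ',
    iteratedDeriv_fun_add (by fun_prop) (by fun_prop),
    iteratedDeriv_fun_sub (by fun_prop) (by fun_prop),
    iteratedDeriv_const_mul_field, iteratedDeriv_const_mul_field, iteratedDeriv_const_mul_field,
    iteratedDeriv_succ_id_mul_zero (contDiffAt_gen r x _)] at coeff_eq
  simp only [iteratedDeriv_norlundGen_zero] at coeff_eq
  linear_combination coeff_eq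

theorem sum_choose_mul_lambdaBernoulli_one_one (n : ℕ) (x : ℂ) :
    ∑ k ∈ range (n + 1), ((n + 1).choose k : ℂ) * lambdaBernoulli 1 k 1 x = (n + 1) * x ^ n := by
  have functional_eq : (fun u => norlundGen 1 x u * (exp u - 1)) =ᶠ[nhds 0]
      fun u => u * exp (x * u) := by
    filter_upwards [eventually_nhds_zero_exp_eq_one_imp] with u hu
    rw [norlundGen, pow_one, mul_right_comm, lambdaBernoulliGen_one_mul_exp_sub_one hu]
  have coeff_eq := functional_eq.iteratedDeriv_eq (n + 1)
  rw [iteratedDeriv_fun_mul (analyticAt_norlundGen_zero 1 x).contDiffAt (by fun_prop),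
    sum_range_succ, iteratedDeriv_succ_id_mul_zero (by fun_prop),
    iteratedDeriv_cexp_const_mul] at coeff_eq
  simp only [iteratedDeriv_exp_sub_one_zero, iteratedDeriv_norlundGen_zero, tsub_self, if_true,
    mul_zero, add_zero] at coeff_eq
  calc ∑ k ∈ range (n + 1), ((n + 1).choose k : ℂ) * lambdaBernoulli 1 k 1 x
      = ∑ k ∈ range (n + 1), ((n + 1).choose k : ℂ) * lambdaBernoulli 1 k 1 x *
          (if n + 1 - k = 0 then 0 else 1) := sum_congr rfl fun k hk => by
        rw [if_neg (Nat.sub_ne_zero_of_lt (mem_range.mp hk)), mul_one]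
    _ = (n + 1) * x ^ n := by rw [coeff_eq, exp_zero, mul_one]

theorem lambdaBernoulli_one_one (n : ℕ) (x : ℂ) :
    lambdaBernoulli 1 n 1 x = Polynomial.aeval x (Polynomial.bernoulli n) := by
  induction n using Nat.strong_induction_on with
  | _ n ih =>
    have sum_bernoulli := congrArg (Polynomial.aeval x) (Polynomial.sum_bernoulli n)
    have sum_lambdaBernoulli := sum_choose_mul_lambdaBernoulli_one_one n x
    rw [sum_range_succ] at sum_bernoulli sum_lambdaBernoulli
    have lower_eq : ∀ k ∈ range n, ((n + 1).choose k : ℂ) * lambdaBernoulli 1 k 1 x =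
        ((n + 1).choose k : ℂ) * Polynomial.aeval x (Polynomial.bernoulli k) := fun k hk => by
      rw [ih k (mem_range.mp hk)]
    rw [sum_congr rfl lower_eq] at sum_lambdaBernoulli
    simp only [Algebra.smul_def, Polynomial.algebraMap_eq, map_natCast, Nat.cast_add, Nat.cast_one,
      Nat.choose_succ_self_right, map_add, map_one, map_sum, map_mul, Polynomial.aeval_monomial,
      one_mul] at sum_bernoulli sum_lambdaBernoulli
    refine mul_left_cancel₀ (Nat.cast_add_one_ne_zero n) ?_
    linear_combination sum_lambdaBernoulli - sum_bernoulli

theorem lambdaBernoulli_one_one_one (n : ℕ) : lambdaBernoulli 1 n 1 1 = (bernoulli' n : ℂ) := by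
  rw [lambdaBernoulli_one_one, ← map_one (algebraMap ℚ ℂ),
    Polynomial.aeval_algebraMap_apply_eq_algebraMap_eval, Polynomial.bernoulli_eval_one,
    eq_ratCast]

theorem multipleZetaSucc_neg_natCast (k m : ℕ) :
    multipleZetaSucc k (-m) = (-1) ^ (k + 1) * m.factorial *
      (lambdaBernoulli (k + 1) (m + (k + 1)) 1 (k + 1) / (m + (k + 1)).factorial) := by
  induction k generalizing m with
  | zero =>
    have factorial_ne : (m.factorial : ℂ) ≠ 0 := Nat.cast_ne_zero.mpr m.factorial_ne_zero
    simp only [multipleZetaSucc, riemannZeta_neg_nat_eq_bernoulli', Nat.cast_zero, zero_add,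
      lambdaBernoulli_one_one_one, Nat.factorial_succ]
    push_cast
    field_simp
  | succ k ih =>
    have order_rec := lambdaBernoulli_one_succ_order (k + 1) (m + (k + 1)) (k + 1)
    have zeta_pred := ih (m + 1)
    rw [show m + 1 + (k + 1) = m + (k + 1) + 1 by ring] at zeta_pred
    have factorial_ne : ((m + (k + 1)).factorial : ℂ) ≠ 0 :=
      Nat.cast_ne_zero.mpr (m + (k + 1)).factorial_ne_zero
    have succ_ne : ((m + (k + 1) : ℕ) : ℂ) + 1 ≠ 0 := Nat.cast_add_one_ne_zero _
    simp only [multipleZetaSucc]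
    rw [show -(m : ℂ) - 1 = -((m + 1 : ℕ) : ℂ) by push_cast; ring, zeta_pred, ih m,
      show m + (k + 1 + 1) = m + (k + 1) + 1 by ring, Nat.factorial_succ, Nat.factorial_succ]
    push_cast at order_rec succ_ne ⊢
    field_simp
    linear_combination (-1) ^ (k + 1) * (m.factorial : ℂ) * order_rec

end Norlund

section LambdaExpansion

open Complex

theorem lambdaBernoulliGen_eq_one_log_add {lam : ℂ} (hlam : lam ≠ 0) (t : ℂ) :
    lambdaBernoulliGen lam t = lambdaBernoulliGen 1 (log lam + t) := by
  simp [lambdaBernoulliGen, exp_add, exp_log hlam]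

theorem lambdaBernoulli_eq_cpow_mul_iteratedDeriv_norlundGen (r n : ℕ) {lam : ℂ}
    (hlam : lam ≠ 0) (x : ℂ) :
    lambdaBernoulli r n lam x = lam ^ (-x) * iteratedDeriv n (norlundGen r x) (log lam) := by
  have gen_eq (t : ℂ) : lambdaBernoulliGen lam t ^ r * exp (x * t) =
      lam ^ (-x) * norlundGen r x (log lam + t) := by
    rw [lambdaBernoulliGen_eq_one_log_add hlam, norlundGen, cpow_def_of_ne_zero hlam,
      mul_left_comm, ← exp_add]
    ring_nf
  rw [lambdaBernoulli, funext gen_eq, iteratedDeriv_const_mul_field, iteratedDeriv_comp_const_add]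
  simp only [add_zero]

theorem ringChoose_neg_natCast_sub_one (N j : ℕ) :
    Ring.choose (-(N : ℤ) - 1) j = (-1) ^ j * ((N + j).choose N : ℤ) := by
  rw [show -(N : ℤ) - 1 = -((N + 1 : ℕ) : ℤ) by push_cast; ring, Ring.choose_neg,
    show ((N + 1 : ℕ) : ℤ) + j - 1 = ((N + j : ℕ) : ℤ) by push_cast; ring, Ring.choose_natCast,
    Nat.choose_symm_add]
  simp [Int.negOnePow, Units.smul_def]

theorem abs_log_im_lt_pi {lam : ℂ} (hlam : lam ∈ slitPlane) : |(log lam).im| < Real.pi := by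
  rw [log_im, abs_lt]
  exact ⟨neg_pi_lt_arg _, (arg_le_pi _).lt_of_ne (slitPlane_arg_ne_pi hlam)⟩

theorem hasSum_choose_mul_log_pow_mul_lambdaBernoulli (r N : ℕ) {lam : ℂ}
    (hlam : lam ∈ slitPlane) (x : ℂ) :
    HasSum (fun j : ℕ => ((Ring.choose (-(N : ℤ) - 1) j : ℤ) : ℂ) * log lam ^ j *
        (lambdaBernoulli r (N + j) lam x / ((N + j).factorial : ℂ)))
      (lam ^ (-x) * (lambdaBernoulli r N 1 x / N.factorial)) := by
  obtain ⟨R, hR, hball⟩ := exists_ball_forall_exp_eq_one_imp (abs_log_im_lt_pi hlam)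
  have taylor := hasSum_taylorSeries_iteratedDeriv_on_ball (z := 0)
    (fun u hu => (differentiableAt_norlundGen r x (hball u hu)).differentiableWithinAt)
    (by simpa using hR) N
  have scaled := (taylor.div_const (N.factorial : ℂ)).mul_left (lam ^ (-x))
  rw [iteratedDeriv_norlundGen_zero] at scaled
  refine scaled.congr_fun fun j => ?_
  have factorial_ne : ((N + j).factorial : ℂ) ≠ 0 := Nat.cast_ne_zero.mpr (N + j).factorial_ne_zero
  rw [lambdaBernoulli_eq_cpow_mul_iteratedDeriv_norlundGen r _ (slitPlane_ne_zero hlam),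
    ringChoose_neg_natCast_sub_one]
  push_cast
  rw [Nat.cast_add_choose, zero_sub, neg_pow (log lam), smul_eq_mul, smul_eq_mul]
  field_simp

end LambdaExpansion

theorem theorem11 (r m : ℕ) (hr : 0 < r) (hm : 0 < m) :
    (∃ Z : ℂ → ℂ, IsMultipleZeta r Z) ∧
    ∀ Z : ℂ → ℂ, IsMultipleZeta r Z →
      ∀ lam : ℂ, lam ∈ Complex.slitPlane →
        Summable (fun j : ℕ =>
          ((Ring.choose (-(m : ℤ) - (r : ℤ) - 1) j : ℤ) : ℂ) * Complex.log lam ^ j *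
            (lambdaBernoulli r (m + r + j) lam (r : ℂ) / ((m + r + j).factorial : ℂ))) ∧
        Z (-(m : ℂ)) = (-lam) ^ r * (m.factorial : ℂ) *
          ∑' j : ℕ, ((Ring.choose (-(m : ℤ) - (r : ℤ) - 1) j : ℤ) : ℂ) * Complex.log lam ^ j *
            (lambdaBernoulli r (m + r + j) lam (r : ℂ) / ((m + r + j).factorial : ℂ)) := by
  obtain ⟨k, rfl⟩ : ∃ k, r = k + 1 := Nat.exists_eq_add_one.mpr hr
  have hzeta := isMultipleZeta_multipleZetaSucc k
  refine ⟨⟨_, hzeta⟩, fun Z hZ lam hlam => ?_⟩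
  have expansion :=
    hasSum_choose_mul_log_pow_mul_lambdaBernoulli (k + 1) (m + (k + 1)) hlam ((k + 1 : ℕ) : ℂ)
  rw [show -((m + (k + 1) : ℕ) : ℤ) - 1 = -(m : ℤ) - ((k + 1 : ℕ) : ℤ) - 1 by push_cast; ring]
    at expansion
  refine ⟨expansion.summable, ?_⟩
  have lam_pow_ne : lam ^ (k + 1) ≠ 0 := pow_ne_zero _ (Complex.slitPlane_ne_zero hlam)
  rw [expansion.tsum_eq, hZ.eqOn hzeta (neg_natCast_notMem_multipleZetaPoles _ m),
    multipleZetaSucc_neg_natCast, neg_pow lam, Complex.cpow_neg, Complex.cpow_natCast]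
  push_cast
  field_simp
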